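/- For a positive integer $n$ let $\Omega_n=\{0,1,-1,2,-2,\dots,n,-n\}$, and let $\mathfrak{B}_n$ be the group of signed permutations of length $n$, i.e. of bijections $\pi:\Omega_n\to\Omega_n$ with $\pi(-a)=-\pi(a)$ for all $a\in\Omega_n$. For $\pi\in\mathfrak{B}_n$ let $\mathrm{des}^B(\pi)=|\{i\in\{0,1,\dots,n-1\} : \pi(i)>\pi(i+1)\}|$ be the number of descents with respect to the natural order on $\mathbb{Z}$ (note that $\pi(0)=0$). For an integer $k$ let $I^{\overline{B}}_{n,k}$ be the number of signed involutions $\pi\in\mathfrak{B}_n$ (i.e. $\pi^{-1}=\pi$) with $\mathrm{des}^B(\pi)=k$. Theorem. For all integers $n\ge 3$ and $k\ge 0$, $$ \begin{aligned} n\,I^{\overline{B}}_{n,k}={}&(2k+1)\,I^{\overline{B}}_{n-1,k}+(2n-2k+1)\,I^{\overline{B}}_{n-1,k-1}+\bigl(n-1+2k(k+1)\bigr)I^{\overline{B}}_{n-2,k}\\ &+\bigl(2(n-1)+4(n-k-1)(k-1)\bigr)I^{\overline{B}}_{n-2,k-1}\\ &+\bigl((2n-3)(n-1)+2(k-2)(k-2n+1)\bigr)I^{\overline{B}}_{n-2,k-2},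 \end{aligned} $$ where $I^{\overline{B}}_{1,0}=1$, $I^{\overline{B}}_{1,1}=1$, $I^{\overline{B}}_{2,0}=1$, $I^{\overline{B}}_{2,1}=4$, $I^{\overline{B}}_{2,2}=1$, and $I^{\overline{B}}_{n,k}=0$ for all $n\ge 1$ and $k<0$. -/

import Mathlib

namespace SignedPerm

/-- The set `{0, 1, -1, 2, -2, …, n, -n}`. -/
abbrev Omega (n : ℕ) : Type := {a : ℤ // a ∈ Finset.Icc (-(n : ℤ)) (n : ℤ)}

/-- Negation `a ↦ -a` on `Omega n`. -/
def Omega.neg {n : ℕ} (a : Omega n) : Omega n :=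
  ⟨-a.1, by have h := Finset.mem_Icc.1 a.2; exact Finset.mem_Icc.2 ⟨by lia, by lia⟩⟩

/-- The element `m` of `Omega n`, for a natural number `m ≤ n`. -/
def Omega.ofNat {n : ℕ} (m : ℕ) (hm : m ≤ n) : Omega n :=
  ⟨(m : ℤ), Finset.mem_Icc.2 ⟨by lia, by lia⟩⟩

/-- A bijection `π` of `Omega n` is a signed permutation of length `n` if
`π (-a) = -π a` for all `a`. -/
def IsSigned {n : ℕ} (π : Equiv.Perm (Omega n)) : Prop :=
  ∀ a : Omega n, π a.neg = (π a).neg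

noncomputable instance {n : ℕ} (π : Equiv.Perm (Omega n)) : Decidable (IsSigned π) :=
  inferInstanceAs (Decidable (∀ a : Omega n, π a.neg = (π a).neg))

/-- The hyperoctahedral group: the set of all signed permutations of length `n`. -/
noncomputable def signedPerms (n : ℕ) : Finset (Equiv.Perm (Omega n)) :=
  {π | IsSigned π}

/-- The descent set of `π` in the natural order: the indices `i ∈ {0, 1, …, n - 1}` with
`π i > π (i + 1)`. -/
noncomputable def descentSet {n : ℕ} (π : Equiv.Perm (Omega n)) : Finset (Fin n) :=
  {i | (π (Omega.ofNat ((i : ℕ) + 1) i.2) : ℤ) < (π (Omega.ofNat (i : ℕ) i.2.le) : ℤ)}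

/-- The number of descents of `π` in the natural order. -/
noncomputable def des {n : ℕ} (π : Equiv.Perm (Omega n)) : ℕ := (descentSet π).card

/-- The set of signed involutions of length `n`. -/
noncomputable def signedInvolutions (n : ℕ) : Finset (Equiv.Perm (Omega n)) :=
  {π ∈ signedPerms n | π⁻¹ = π}

/-- The number of signed involutions of length `n` with exactly `k` descents in the natural
order, for an arbitrary integer `k`. -/
noncomputable def numInvolutions (n : ℕ) (k : ℤ) : ℕ :=
  {π ∈ signedInvolutions n | (des π : ℤ) = k}.card

end SignedPerm

/-!
Let `a n r` be the number of multisets of `2 n + 1` pairs of labels in `{0, ±1, …, ±r}` that are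
invariant under exchanging the two labels of each pair and under negating all labels.

Sorting such a multiset gives a word of pairs `(f a, f (π a))` indexed by `Omega n`, where `π` is a
signed involution and `f` is an odd, weakly increasing labelling along whose level sets `π`
increases; `π` is recovered as the standardization of `f ∘ π`. For fixed `π` there are
`(r - des π + n).choose n` such labellings if `des π ≤ r`, and none otherwise. Hence
`∑ r, a n r * t ^ r = (∑ k, I_{n, k} * t ^ k) / (1 - t) ^ (n + 1)`.

The group generated by the exchange and the negation has one orbit of size 1, `2 r` orbits of size 2
and `r ^ 2` orbits of size 4 on pairs of labels, so symmetric multisets of arbitrary size have the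
generating function `1 / ((1 - X) (1 - X ^ 2) ^ (2 r) (1 - X ^ 4) ^ (r ^ 2))`. Its odd part gives
`∑ n, a n r * X ^ n = 1 / ((1 - X) ^ (2 r + 1) (1 - X ^ 2) ^ (r ^ 2))`, whose logarithmic derivative
is a three-term recurrence in `n` with coefficients polynomial in `r`. Multiplication by `r` is the
operator `t d/dt` on series in `t`, and on numerators over powers of `1 - t` it becomes an Eulerian
operator; reading off the coefficients of the numerators gives the recurrence for `I_{n, k}`.
-/

namespace SignedPerm

open Equiv (Perm)

section Standardization

variable {α β : Type*} [LinearOrder α] [LinearOrder β]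

theorem perm_eq_of_lt_iff [WellFoundedLT α] {π σ : Perm α}
    (h : ∀ a b, π a < π b ↔ σ a < σ b) : π = σ := by
  have hle : ∀ a b, (σ.symm.trans π) a ≤ (σ.symm.trans π) b ↔ a ≤ b := fun a b => by
    simpa using not_congr (h (σ.symm b) (σ.symm a))
  have hid : (⟨σ.symm.trans π, hle _ _⟩ : α ≃o α) = OrderIso.refl α := Subsingleton.elim _ _
  ext a
  simpa using DFunLike.congr_fun hid (σ a)

variable [Fintype α]

open Classical in
/-- The standardization of a word `w`: the permutation sending each position to the rank of its
letter, equal letters being ranked from left to right. -/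
noncomputable def standardization (w : α → β) : Perm α :=
  have hinj : Function.Injective fun a => toLex (w a, a) := fun _ _ h => congrArg Prod.snd h
  (Equiv.ofInjective _ hinj).trans <|
    ((Fintype.orderIsoFinOfCardEq _ (Set.card_range_of_injective hinj)).symm.trans
      (Fintype.orderIsoFinOfCardEq α rfl)).toEquiv

theorem standardization_lt_iff (w : α → β) (a b : α) :
    standardization w a < standardization w b ↔ toLex (w a, a) < toLex (w b, b) := by
  simp only [standardization, Equiv.trans_apply, OrderIso.coe_toEquiv, OrderIso.lt_iff_lt]
  rfl

theorem strictMono_standardization_symm (w : α → β) :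
    StrictMono fun a => toLex (w ((standardization w).symm a), (standardization w).symm a) :=
  fun a b hab => (standardization_lt_iff w _ _).1 (by simpa using hab)

theorem eq_standardization {w : α → β} {π : Perm α}
    (h : StrictMono fun a => toLex (w (π.symm a), π.symm a)) : π = standardization w :=
  perm_eq_of_lt_iff fun a b => by
    simpa [standardization_lt_iff] using (h.lt_iff_lt (a := π a) (b := π b)).symm

theorem standardization_apply_of_odd {ν : α → α} {μ : β → β} (hν : Function.Involutive ν)
    (hν' : StrictAnti ν) (hμ : StrictAnti μ) {w : α → β} (hw : ∀ a, w (ν a) = μ (w a)) (a : α) :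
    standardization w (ν a) = ν (standardization w a) := by
  have h : (hν.toPerm.trans (standardization w)).trans hν.toPerm = standardization w :=
    perm_eq_of_lt_iff fun a b => by
      simp only [Equiv.trans_apply, Function.Involutive.coe_toPerm, hν'.lt_iff_gt,
        standardization_lt_iff, Prod.Lex.toLex_lt_toLex, hw, hμ.lt_iff_gt, hμ.injective.eq_iff,
        eq_comm]
  rw [← hν.eq_iff]
  exact Equiv.congr_fun h a

end Standardization

section MonotoneRearrangement

variable {α γ : Type*} [LinearOrder α] [Fintype α] [LinearOrder γ]

theorem eq_of_monotone_of_map_univ_eq {f g : α → γ} (hf : Monotone f) (hg : Monotone g)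
    (h : (Finset.univ : Finset α).val.map f = (Finset.univ : Finset α).val.map g) : f = g := by
  have hsort {e : α → γ} (he : Monotone e) :
      ((Finset.univ.sort (· ≤ ·)).map e).Pairwise (· ≤ ·) :=
    List.pairwise_map.2 <| (Finset.pairwise_sort _ _).imp fun hab => he hab
  rw [← Finset.sort_eq Finset.univ (· ≤ ·), Multiset.map_coe, Multiset.map_coe,
    Multiset.coe_eq_coe] at h
  have hlist := h.eq_of_pairwise (fun _ _ _ _ => le_antisymm) (hsort hf) (hsort hg)
  funext a
  exact List.map_inj_left.1 hlist a (by simp)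

theorem exists_monotone_map_univ_eq {M : Multiset γ} (hM : M.card = Fintype.card α) :
    ∃ f : α → γ, Monotone f ∧ (Finset.univ : Finset α).val.map f = M := by
  let l := M.sort (· ≤ ·)
  let e : Fin l.length ≃o α := Fintype.orderIsoFinOfCardEq α (by simp [l, hM])
  refine ⟨l.get ∘ e.symm, (M.pairwise_sort (· ≤ ·)).sortedLE.monotone_get.comp e.symm.monotone, ?_⟩
  have he : (Finset.univ : Finset α).val.map e.symm = Finset.univ.val :=
    Multiset.map_univ_val_equiv e.symm.toEquiv
  rw [← Multiset.map_map, he, Fin.univ_val_map, List.ofFn_get]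
  exact M.sort_eq _

theorem bijOn_map_univ_monotone :
    Set.BijOn (fun f : α → γ => Finset.univ.val.map f) {f | Monotone f}
      {M | M.card = Fintype.card α} :=
  ⟨fun _ _ => by simp, fun _ hf _ hg => eq_of_monotone_of_map_univ_eq hf hg,
    fun _ hM => exists_monotone_map_univ_eq hM⟩

theorem ncard_monotone_fin (n m : ℕ) :
    {g : Fin n → Fin m | Monotone g}.ncard = m.multichoose n := by
  have h := bijOn_map_univ_monotone (α := Fin n) (γ := Fin m)
  rw [← h.injOn.ncard_image, h.image_eq, Fintype.card_fin, ← Nat.card_coe_set_eq]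
  have hsym := Sym.card_sym_eq_multichoose (Fin m) n
  rw [Fintype.card_fin, ← Nat.card_eq_fintype_card] at hsym
  exact hsym

end MonotoneRearrangement

section Compatible

variable {α β : Type*} [LinearOrder α] [LinearOrder β]

/-- `f` is a labelling compatible with `π`: it is odd, it increases weakly, and on each set of
positions with the same label `π` increases. The last two conditions say that
`a ↦ (f a, π a)` increases strictly in the lexicographic order. The maps `ν` and `μ` play the role
of `a ↦ -a` on positions and on labels. -/
structure IsCompatible (ν : α → α) (μ : β → β) (π : Perm α) (f : α → β) : Prop where
  odd : ∀ a, f (ν a) = μ (f a)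
  strictMono : StrictMono fun a => toLex (f a, π a)

/-- The pairs of an involution commuting with `ν` and a labelling compatible with it. -/
def compatiblePairs (ν : α → α) (μ : β → β) : Set (Perm α × (α → β)) :=
  {p | Function.Involutive p.1 ∧ (∀ a, p.1 (ν a) = ν (p.1 a)) ∧ IsCompatible ν μ p.1 p.2}

/-- The multisets of `N` pairs that are invariant under exchanging the components of the pairs and
under `μ`; viewed as matrices of multiplicities, they are the symmetric matrices with entry sum `N`
invariant under `μ`. -/
def symmMultisets {β : Type*} (μ : β → β) (N : ℕ) : Set (Multiset (β × β)) :=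
  {M | M.card = N ∧ M.map Prod.swap = M ∧ M.map (Prod.map μ μ) = M}

variable {ν : α → α} {μ : β → β} {π : Perm α} {f : α → β}

theorem IsCompatible.monotone_toLex (h : IsCompatible ν μ π f) :
    Monotone fun a => toLex (f a, f (π a)) := by
  have hf : Monotone f := fun a b hab => (Prod.Lex.toLex_le_toLex'.1 (h.strictMono.monotone hab)).1
  exact fun a b hab => Prod.Lex.toLex_le_toLex'.2
    ⟨hf hab, fun he => hf <| (Prod.Lex.toLex_le_toLex'.1 (h.strictMono.monotone hab)).2 he⟩

theorem map_univ_val_comp_equiv {α γ : Type*} [Fintype α] (u : α → γ) (σ : Perm α) :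
    (Finset.univ : Finset α).val.map (fun a => u (σ a)) = Finset.univ.val.map u := by
  conv_rhs => rw [← Multiset.map_univ_val_equiv σ, Multiset.map_map]
  rfl

variable [Fintype α]

theorem IsCompatible.eq_standardization (h : IsCompatible ν μ π f) (hπ : Function.Involutive π) :
    π = standardization (f ∘ π) := by
  refine SignedPerm.eq_standardization ?_
  simpa [Function.Involutive.symm_eq_self_of_involutive π hπ, hπ _] using h.strictMono

theorem eq_of_monotone_toLex {u v : α → β × β} (hu : Monotone fun a => toLex (u a))
    (hv : Monotone fun a => toLex (v a))
    (h : (Finset.univ : Finset α).val.map u = (Finset.univ : Finset α).val.map v) : u = v := by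
  have hlex : (fun a => toLex (u a)) = fun a => toLex (v a) :=
    eq_of_monotone_of_map_univ_eq hu hv <| by
      simpa only [Multiset.map_map, Function.comp_def] using congrArg (Multiset.map toLex) h
  exact funext fun a => toLex.injective (congrFun hlex a)

theorem exists_monotone_toLex_map_univ_eq {M : Multiset (β × β)} (hM : M.card = Fintype.card α) :
    ∃ u : α → β × β, (Monotone fun a => toLex (u a)) ∧ Finset.univ.val.map u = M := by
  obtain ⟨v, hv, hvM⟩ := exists_monotone_map_univ_eq (α := α) (M := M.map toLex) (by simpa)
  refine ⟨fun a => ofLex (v a), hv, ?_⟩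
  simpa [Multiset.map_map, Function.comp_def] using congrArg (Multiset.map ofLex) hvM

/-- The multiset of the pairs formed by the label of a position and the label of its image. It
encodes a compatible pair because the sorted list of these pairs is the word `a ↦ (f a, f (π a))`,
and `π` is the standardization of `f ∘ π`. -/
def labelPairs (p : Perm α × (α → β)) : Multiset (β × β) :=
  Finset.univ.val.map fun a => (p.2 a, p.2 (p.1 a))

theorem injOn_labelPairs :
    Set.InjOn labelPairs (compatiblePairs ν μ : Set (Perm α × (α → β))) := by
  rintro ⟨π, f⟩ ⟨hπ, -, hf : IsCompatible ν μ π f⟩ ⟨σ, g⟩ ⟨hσ, -, hg : IsCompatible ν μ σ g⟩ heq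
  have hword := eq_of_monotone_toLex hf.monotone_toLex hg.monotone_toLex heq
  have hfg : f = g := funext fun a => congrArg Prod.fst (congrFun hword a)
  have hfg' : f ∘ π = g ∘ σ := funext fun a => congrArg Prod.snd (congrFun hword a)
  have hπσ : π = σ := by
    rw [hf.eq_standardization hπ, hg.eq_standardization hσ]
    exact congrArg standardization hfg'
  rw [hπσ, hfg]

theorem mapsTo_labelPairs (hν : Function.Involutive ν) :
    Set.MapsTo labelPairs (compatiblePairs ν μ : Set (Perm α × (α → β)))
      (symmMultisets μ (Fintype.card α)) := by
  rintro ⟨π, f⟩ ⟨hπ : ∀ a, π (π a) = a, hodd : ∀ a, π (ν a) = ν (π a), hf⟩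
  have hf' : ∀ a, f (ν a) = μ (f a) := hf.odd
  let u : α → β × β := fun a => (f a, f (π a))
  refine ⟨by simp [labelPairs], ?_, ?_⟩
  · simpa [labelPairs, u, hπ] using map_univ_val_comp_equiv u π
  · simpa [labelPairs, u, hodd, hf'] using map_univ_val_comp_equiv u hν.toPerm

theorem monotone_toLex_swap_standardization {u : α → β × β} (hu : Monotone fun a => toLex (u a)) :
    Monotone fun a => toLex (u ((standardization fun a => (u a).2).symm a)).swap := by
  intro a b hab
  have h := Prod.Lex.toLex_le_toLex'.1
    ((strictMono_standardization_symm fun a => (u a).2).monotone hab)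
  exact Prod.Lex.toLex_le_toLex'.2
    ⟨h.1, fun he => (Prod.Lex.toLex_le_toLex'.1 (hu (h.2 he))).1⟩

theorem apply_odd_of_map_univ_eq (hν : Function.Involutive ν) (hνa : Antitone ν)
    (hμ : Function.Involutive μ) (hμa : Antitone μ) {u : α → β × β}
    (hu : Monotone fun a => toLex (u a))
    (h : (Finset.univ.val.map u).map (Prod.map μ μ) = Finset.univ.val.map u) (a : α) :
    u (ν a) = Prod.map μ μ (u a) := by
  have hodd : (fun a => Prod.map μ μ (u (ν a))) = u := by
    refine eq_of_monotone_toLex (fun a b hab => ?_) hu ?_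
    · have hle := Prod.Lex.toLex_le_toLex'.1 (hu (hνa hab))
      exact Prod.Lex.toLex_le_toLex'.2
        ⟨hμa hle.1, fun he => hμa (hle.2 (hμ.injective he.symm))⟩
    · rw [← h, Multiset.map_map]
      exact map_univ_val_comp_equiv (Prod.map μ μ ∘ u) hν.toPerm
  rw [← congrFun hodd (ν a), hν a]

theorem apply_standardization_eq {u : α → β × β} (hu : Monotone fun a => toLex (u a))
    (h : (Finset.univ.val.map u).map Prod.swap = Finset.univ.val.map u) (a : α) :
    u (standardization (fun a => (u a).2) a) = (u a).swap := by
  have hswap : (fun a => (u ((standardization fun a => (u a).2).symm a)).swap) = u := by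
    refine eq_of_monotone_toLex (monotone_toLex_swap_standardization hu) hu ?_
    rw [← h, Multiset.map_map]
    exact map_univ_val_comp_equiv (Prod.swap ∘ u) (standardization fun a => (u a).2).symm
  rw [← congrFun hswap, Equiv.symm_apply_apply]

theorem strictMono_toLex_standardization {u : α → β × β} (hu : Monotone fun a => toLex (u a)) :
    StrictMono fun a => toLex ((u a).1, standardization (fun a => (u a).2) a) := by
  intro a b hab
  have hle := Prod.Lex.toLex_le_toLex'.1 (hu hab.le)
  exact Prod.Lex.toLex_lt_toLex'.2 ⟨hle.1, fun he => (standardization_lt_iff _ _ _).2 <|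
    Prod.Lex.toLex_lt_toLex'.2 ⟨hle.2 he, fun _ => hab⟩⟩

theorem involutive_standardization {u : α → β × β} (hu : Monotone fun a => toLex (u a))
    (h : (Finset.univ.val.map u).map Prod.swap = Finset.univ.val.map u) :
    Function.Involutive (standardization fun a => (u a).2) := by
  have hsymm : (standardization fun a => (u a).2).symm = standardization fun a => (u a).2 := by
    refine eq_standardization ?_
    simpa [apply_standardization_eq hu h] using strictMono_toLex_standardization hu
  exact fun a => by rw [← Equiv.eq_symm_apply, hsymm]

theorem surjOn_labelPairs (hν : Function.Involutive ν) (hνa : Antitone ν)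
    (hμ : Function.Involutive μ) (hμa : Antitone μ) :
    Set.SurjOn labelPairs (compatiblePairs ν μ : Set (Perm α × (α → β)))
      (symmMultisets μ (Fintype.card α)) := by
  rintro M ⟨hcard, hswap, hneg⟩
  obtain ⟨u, hu, rfl⟩ := exists_monotone_toLex_map_univ_eq hcard
  have hodd := apply_odd_of_map_univ_eq hν hνa hμ hμa hu hneg
  have hodd₁ : ∀ a, (u (ν a)).1 = μ (u a).1 := fun a => congrArg Prod.fst (hodd a)
  have hodd₂ : ∀ a, (u (ν a)).2 = μ (u a).2 := fun a => congrArg Prod.snd (hodd a)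
  refine ⟨(standardization fun a => (u a).2, fun a => (u a).1),
    ⟨involutive_standardization hu hswap, standardization_apply_of_odd hν
      (hνa.strictAnti_of_injective hν.injective) (hμa.strictAnti_of_injective hμ.injective) hodd₂,
      hodd₁, strictMono_toLex_standardization hu⟩, ?_⟩
  simp [labelPairs, apply_standardization_eq hu hswap]

theorem ncard_compatiblePairs (hν : Function.Involutive ν) (hνa : Antitone ν)
    (hμ : Function.Involutive μ) (hμa : Antitone μ) :
    (compatiblePairs ν μ : Set (Perm α × (α → β))).ncard =
      (symmMultisets μ (Fintype.card α)).ncard := by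
  rw [← (mapsTo_labelPairs hν).image_subset.antisymm (surjOn_labelPairs hν hνa hμ hμa),
    injOn_labelPairs.ncard_image]

end Compatible

section Sequences

variable {n : ℕ}

theorem partialSum_last (ε : Fin n → ℕ) : Fin.partialSum ε (Fin.last n) = ∑ i, ε i := by
  simp [Fin.partialSum, List.sum_ofFn, List.take_of_length_le]

/-- The sequences `0 = h 0, h 1, …, h n ≤ r` whose `i`-th increment is at least `ε i`. -/
def boundedSequences (ε : Fin n → ℕ) (r : ℕ) : Set (Fin (n + 1) → ℕ) :=
  {h | h 0 = 0 ∧ (∀ i : Fin n, h i.castSucc + ε i ≤ h i.succ) ∧ h (Fin.last n) ≤ r}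

variable {ε : Fin n → ℕ} {r : ℕ} {h : Fin (n + 1) → ℕ}

theorem monotone_of_mem_boundedSequences (hh : h ∈ boundedSequences ε r) : Monotone h :=
  Fin.monotone_iff_le_succ.2 fun i => le_of_add_le_left (hh.2.1 i)

theorem partialSum_le_of_mem_boundedSequences (hh : h ∈ boundedSequences ε r) (i : Fin (n + 1)) :
    Fin.partialSum ε i ≤ h i := by
  induction i using Fin.induction with
  | zero => simp
  | succ i ih => exact Fin.partialSum_succ ε i ▸ (Nat.add_le_add_right ih _).trans (hh.2.1 i)

theorem monotone_sub_partialSum (hh : h ∈ boundedSequences ε r) :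
    Monotone fun i => h i - Fin.partialSum ε i := by
  refine Fin.monotone_iff_le_succ.2 fun i => ?_
  have := hh.2.1 i
  rw [Fin.partialSum_succ]
  omega

theorem add_partialSum_mem_boundedSequences {g : Fin n → Fin (r + 1 - ∑ i, ε i)}
    (hg : Monotone g) :
    (Fin.cons 0 (fun i => (g i : ℕ)) + Fin.partialSum ε : Fin (n + 1) → ℕ) ∈
      boundedSequences ε r := by
  have hmono : Monotone (Fin.cons 0 fun i => (g i : ℕ) : Fin (n + 1) → ℕ) := by
    intro i j hij
    cases i using Fin.cases <;> cases j using Fin.cases <;> simp_all [hg _]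
  refine ⟨by simp, fun i => ?_, ?_⟩
  · have := Fin.monotone_iff_le_succ.1 hmono i
    simp only [Pi.add_apply, Fin.partialSum_succ] at this ⊢
    omega
  · rw [Pi.add_apply, partialSum_last]
    cases n with
    | zero => simp
    | succ n =>
      have := (g (Fin.last n)).2
      rw [← Fin.succ_last, Fin.cons_succ]
      omega

theorem bijOn_boundedSequences (ε : Fin n → ℕ) (r : ℕ) :
    Set.BijOn (fun g : Fin n → Fin (r + 1 - ∑ i, ε i) =>
        (Fin.cons 0 (fun i => (g i : ℕ)) + Fin.partialSum ε : Fin (n + 1) → ℕ))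
      {g | Monotone g} (boundedSequences ε r) := by
  refine ⟨fun g hg => add_partialSum_mem_boundedSequences hg, fun g _ g' _ hgg' => ?_,
    fun h hh => ?_⟩
  · funext i
    simpa [Fin.ext_iff] using congrFun hgg' i.succ
  · have hlt (i : Fin (n + 1)) : h i - Fin.partialSum ε i < r + 1 - ∑ i, ε i := by
      have hle := monotone_sub_partialSum hh i.le_last
      have hlast := partialSum_le_of_mem_boundedSequences hh (Fin.last n)
      have := hh.2.2
      simp only [partialSum_last] at hle hlast
      omega
    refine ⟨fun i => ⟨_, hlt i.succ⟩, fun i j hij =>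
      monotone_sub_partialSum hh (Fin.succ_le_succ_iff.2 hij), ?_⟩
    funext i
    refine Fin.cases ?_ (fun i => ?_) i
    · simp [hh.1]
    · simpa using Nat.sub_add_cancel (partialSum_le_of_mem_boundedSequences hh i.succ)

theorem ncard_boundedSequences (ε : Fin n → ℕ) (r : ℕ) :
    (boundedSequences ε r).ncard = (r + 1 - ∑ i, ε i).multichoose n := by
  have h := bijOn_boundedSequences ε r
  rw [← h.image_eq, h.injOn.ncard_image, ncard_monotone_fin]

end Sequences

section Labellings

variable {n r : ℕ}

theorem Omega.neg_involutive : Function.Involutive (Omega.neg (n := n)) := fun a =>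
  Subtype.ext (neg_neg (a : ℤ))

theorem Omega.neg_strictAnti : StrictAnti (Omega.neg (n := n)) := fun _ _ h =>
  Subtype.coe_lt_coe.1 (neg_lt_neg (Subtype.coe_lt_coe.2 h))

theorem Omega.card (n : ℕ) : Fintype.card (Omega n) = 2 * n + 1 := by
  simp only [Fintype.card_coe, Int.card_Icc]
  omega

/-- The nonnegative elements of `Omega n`. -/
def Omega.ofFin (i : Fin (n + 1)) : Omega n := Omega.ofNat i (Nat.lt_succ_iff.1 i.2)

theorem Omega.coe_ofFin (i : Fin (n + 1)) : (Omega.ofFin i : ℤ) = i := rfl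

theorem Omega.coe_neg (a : Omega n) : (a.neg : ℤ) = -a := rfl

theorem Omega.ofFin_strictMono : StrictMono (Omega.ofFin (n := n)) := fun i j hij => by
  simpa [← Subtype.coe_lt_coe, Omega.coe_ofFin]

theorem Omega.exists_ofFin {a : Omega n} (ha : Omega.ofFin 0 ≤ a) : ∃ i, Omega.ofFin i = a := by
  have h := Finset.mem_Icc.1 a.2
  exact ⟨⟨(a : ℤ).toNat, by lia⟩, Subtype.ext (Int.toNat_of_nonneg ha)⟩

theorem Omega.ofFin_zero_le_neg {a : Omega n} : Omega.ofFin 0 ≤ a.neg ↔ a ≤ Omega.ofFin 0 := by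
  simp [← Subtype.coe_le_coe, Omega.coe_ofFin, Omega.coe_neg]

theorem Omega.strictMono_iff_of_odd {γ : Type*} [Preorder γ] {N : γ → γ} (hN : StrictAnti N)
    {φ : Omega n → γ} (hφ : ∀ a, φ a.neg = N (φ a)) :
    StrictMono φ ↔ ∀ i : Fin n, φ (Omega.ofFin i.castSucc) < φ (Omega.ofFin i.succ) := by
  refine ⟨fun h i => h <| Omega.ofFin_strictMono i.castSucc_lt_succ, fun h => ?_⟩
  have hnonneg : StrictMonoOn φ (Set.Ici (Omega.ofFin 0)) := by
    intro a ha b hb hab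
    obtain ⟨i, rfl⟩ := Omega.exists_ofFin ha
    obtain ⟨j, rfl⟩ := Omega.exists_ofFin hb
    exact Fin.strictMono_iff_lt_succ (f := φ ∘ Omega.ofFin).2 h
      (Omega.ofFin_strictMono.lt_iff_lt.1 hab)
  refine StrictMonoOn.Iic_union_Ici (a := Omega.ofFin 0) (fun a ha b hb hab => ?_) hnonneg
  rw [← Omega.neg_involutive a, ← Omega.neg_involutive b, hφ, hφ b.neg]
  exact hN (hnonneg (Omega.ofFin_zero_le_neg.2 hb) (Omega.ofFin_zero_le_neg.2 ha)
    (Omega.neg_strictAnti hab))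

variable {π : Perm (Omega n)} {f : Omega n → Omega r}

/-- The indicator of the descents of `π`: the least admissible increments of the labels of
`0, 1, …, n` under a labelling compatible with `π`. -/
noncomputable def descentIndicator (π : Perm (Omega n)) (i : Fin n) : ℕ :=
  if i ∈ descentSet π then 1 else 0

theorem sum_descentIndicator (π : Perm (Omega n)) : ∑ i, descentIndicator π i = des π := by
  simp [descentIndicator, des]

theorem toLex_ofFin_lt_iff (i : Fin n) :
    toLex (f (Omega.ofFin i.castSucc), π (Omega.ofFin i.castSucc)) <
        toLex (f (Omega.ofFin i.succ), π (Omega.ofFin i.succ)) ↔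
      (f (Omega.ofFin i.castSucc) : ℤ) + descentIndicator π i ≤ f (Omega.ofFin i.succ) := by
  have hne : π (Omega.ofFin i.castSucc) ≠ π (Omega.ofFin i.succ) :=
    π.injective.ne (Omega.ofFin_strictMono i.castSucc_lt_succ).ne
  have hdes : i ∈ descentSet π ↔ ¬ π (Omega.ofFin i.castSucc) < π (Omega.ofFin i.succ) := by
    rw [not_lt, hne.symm.le_iff_lt]
    simp only [descentSet, Finset.mem_filter, Finset.mem_univ, true_and]
    rfl
  by_cases hi : i ∈ descentSet π
  · simp [descentIndicator, hi, Prod.Lex.toLex_lt_toLex, hdes.1 hi]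
  · simp [descentIndicator, hi, Prod.Lex.toLex_lt_toLex, not_not.1 (hdes.not.1 hi),
      ← le_iff_lt_or_eq]

theorem isCompatible_iff (hπ : IsSigned π) :
    IsCompatible Omega.neg Omega.neg π f ↔ (∀ a, f a.neg = (f a).neg) ∧
      ∀ i : Fin n, (f (Omega.ofFin i.castSucc) : ℤ) + descentIndicator π i ≤
        f (Omega.ofFin i.succ) := by
  suffices h : (∀ a, f a.neg = (f a).neg) → ((StrictMono fun a => toLex (f a, π a)) ↔
      ∀ i : Fin n, (f (Omega.ofFin i.castSucc) : ℤ) + descentIndicator π i ≤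
        f (Omega.ofFin i.succ)) from
    ⟨fun hf => ⟨hf.odd, (h hf.odd).1 hf.strictMono⟩, fun hf => ⟨hf.1, (h hf.1).2 hf.2⟩⟩
  intro hf
  have hN : StrictAnti fun p : Omega r ×ₗ Omega n =>
      toLex ((ofLex p).1.neg, (ofLex p).2.neg) := by
    intro p q hpq
    simpa [Prod.Lex.lt_iff, Omega.neg_strictAnti.lt_iff_gt, Omega.neg_involutive.injective.eq_iff,
      eq_comm] using hpq
  rw [Omega.strictMono_iff_of_odd hN fun a => by simp [hf, hπ a]]
  exact forall_congr' toLex_ofFin_lt_iff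

/-- The odd function on `Omega n` with the values `h 0, h 1, …, h n` on nonnegative arguments,
provided that `h 0 = 0`. -/
def oddExtension (h : Fin (n + 1) → ℕ) (hr : ∀ i, h i ≤ r) (a : Omega n) : Omega r :=
  ⟨(a : ℤ).sign * h ⟨(a : ℤ).natAbs, by have := Finset.mem_Icc.1 a.2; lia⟩, by
    have := hr ⟨(a : ℤ).natAbs, by have := Finset.mem_Icc.1 a.2; lia⟩
    rcases (a : ℤ).sign_trichotomy with hs | hs | hs <;>
      rw [hs, Finset.mem_Icc] <;> constructor <;> lia⟩

theorem oddExtension_neg (h : Fin (n + 1) → ℕ) (hr : ∀ i, h i ≤ r) (a : Omega n) :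
    oddExtension h hr a.neg = (oddExtension h hr a).neg :=
  Subtype.ext <| by simp [oddExtension, Omega.coe_neg]

theorem coe_oddExtension_ofFin {h : Fin (n + 1) → ℕ} (hr : ∀ i, h i ≤ r) (h0 : h 0 = 0)
    (i : Fin (n + 1)) : (oddExtension h hr (Omega.ofFin i) : ℤ) = h i := by
  cases i using Fin.cases with
  | zero => simp [oddExtension, Omega.coe_ofFin, h0]
  | succ i =>
    have hsign : ((i : ℤ) + 1).sign = 1 := Int.sign_eq_one_of_pos (by positivity)
    simp only [oddExtension, Omega.coe_ofFin, Fin.val_succ, Nat.cast_succ, hsign, one_mul]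
    rfl

theorem eq_of_odd {f g : Omega n → Omega r} (hf : ∀ a, f a.neg = (f a).neg)
    (hg : ∀ a, g a.neg = (g a).neg) (h : ∀ i, f (Omega.ofFin i) = g (Omega.ofFin i)) : f = g := by
  have hnonneg (a : Omega n) (ha : Omega.ofFin 0 ≤ a) : f a = g a := by
    obtain ⟨i, rfl⟩ := Omega.exists_ofFin ha
    exact h i
  funext a
  rcases le_total (Omega.ofFin 0) a with ha | ha
  · exact hnonneg a ha
  · rw [← Omega.neg_involutive.injective.eq_iff, ← hf, ← hg]
    exact hnonneg _ (Omega.ofFin_zero_le_neg.2 ha)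

theorem IsCompatible.apply_ofFin_zero (hf : IsCompatible Omega.neg Omega.neg π f) :
    (f (Omega.ofFin 0) : ℤ) = 0 := by
  have hneg : (Omega.ofFin 0 : Omega n).neg = Omega.ofFin 0 := Subtype.ext neg_zero
  have hodd := congrArg Subtype.val (hf.odd (Omega.ofFin 0))
  rw [hneg, Omega.coe_neg] at hodd
  lia

theorem IsCompatible.natAbs_apply_ofFin (hf : IsCompatible Omega.neg Omega.neg π f)
    (i : Fin (n + 1)) : ((f (Omega.ofFin i) : ℤ).natAbs : ℤ) = f (Omega.ofFin i) := by
  refine Int.natAbs_of_nonneg (hf.apply_ofFin_zero ▸ ?_)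
  exact (Prod.Lex.toLex_le_toLex'.1
    (hf.strictMono.monotone (Omega.ofFin_strictMono.monotone i.zero_le))).1

theorem bijOn_isCompatible (hπ : IsSigned π) (r : ℕ) :
    Set.BijOn (fun (f : Omega n → Omega r) i => (f (Omega.ofFin i) : ℤ).natAbs)
      {f | IsCompatible Omega.neg Omega.neg π f} (boundedSequences (descentIndicator π) r) := by
  refine ⟨fun f hf => ⟨?_, fun i => ?_, ?_⟩, fun f hf g hg hfg => ?_, fun h hh => ?_⟩
  · simpa using hf.apply_ofFin_zero
  · have := ((isCompatible_iff hπ).1 hf).2 i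
    rw [← hf.natAbs_apply_ofFin i.castSucc, ← hf.natAbs_apply_ofFin i.succ] at this
    exact_mod_cast this
  · have := Finset.mem_Icc.1 (f (Omega.ofFin (Fin.last n))).2
    lia
  · refine eq_of_odd hf.odd hg.odd fun i => Subtype.ext ?_
    rw [← hf.natAbs_apply_ofFin, ← hg.natAbs_apply_ofFin]
    exact_mod_cast congrFun hfg i
  · have hr i : h i ≤ r := (monotone_of_mem_boundedSequences hh i.le_last).trans hh.2.2
    have hval := coe_oddExtension_ofFin hr hh.1
    refine ⟨oddExtension h hr, (isCompatible_iff hπ).2 ⟨oddExtension_neg h hr, fun i => ?_⟩, ?_⟩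
    · rw [hval, hval]
      exact_mod_cast hh.2.1 i
    · simp [hval]

theorem ncard_isCompatible (hπ : IsSigned π) (r : ℕ) :
    {f : Omega n → Omega r | IsCompatible Omega.neg Omega.neg π f}.ncard =
      (r + 1 - des π).multichoose n := by
  have h := bijOn_isCompatible hπ r
  rw [← h.injOn.ncard_image, h.image_eq, ncard_boundedSequences, sum_descentIndicator]

theorem mem_signedInvolutions {π : Perm (Omega n)} :
    π ∈ signedInvolutions n ↔ Function.Involutive π ∧ IsSigned π := by
  simp only [signedInvolutions, signedPerms, Finset.mem_filter, Finset.mem_univ, true_and,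
    and_comm (a := IsSigned π)]
  refine and_congr_left fun _ => ⟨fun h a => ?_, fun h => ?_⟩
  · rw [← Perm.eq_inv_iff_eq, h]
  · exact Function.Involutive.symm_eq_self_of_involutive π h

theorem ncard_symmMultisets_eq_sum (n r : ℕ) :
    (symmMultisets (Omega.neg (n := r)) (2 * n + 1)).ncard =
      ∑ π ∈ signedInvolutions n, (r + 1 - des π).multichoose n := by
  rw [← Omega.card n, ← ncard_compatiblePairs Omega.neg_involutive Omega.neg_strictAnti.antitone
    Omega.neg_involutive Omega.neg_strictAnti.antitone]
  have hpairs : (compatiblePairs Omega.neg Omega.neg : Set (Perm (Omega n) × (Omega n → Omega r)))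
      = {p | p.1 ∈ signedInvolutions n ∧ IsCompatible Omega.neg Omega.neg p.1 p.2} := by
    ext p
    simp only [compatiblePairs, mem_signedInvolutions, IsSigned, Set.mem_ofPred_eq, and_assoc]
  classical
  calc (compatiblePairs Omega.neg Omega.neg : Set (Perm (Omega n) × (Omega n → Omega r))).ncard
      = ∑ π ∈ signedInvolutions n,
          {f : Omega n → Omega r | IsCompatible Omega.neg Omega.neg π f}.ncard := by
        simp only [hpairs, Set.ncard_eq_toFinset_card', Set.toFinset_ofPred, Finset.card_filter,
          Fintype.sum_prod_type, ite_and]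
        simp
    _ = _ := Finset.sum_congr rfl fun π hπ =>
        ncard_isCompatible (mem_signedInvolutions.1 hπ).2 r

end Labellings

section InvariantMultisets

open PowerSeries

variable {R : Type*} [CommRing R]

theorem coeff_expand_mk_one {w : ℕ} (hw : w ≠ 0) (m : ℕ) :
    coeff m (expand w hw (mk 1 : R⟦X⟧)) = if w ∣ m then 1 else 0 := by
  simp [coeff_expand]

theorem expand_mk_one_mul_one_sub_X_pow {w : ℕ} (hw : w ≠ 0) :
    expand w hw (mk 1 : R⟦X⟧) * (1 - X ^ w) = 1 := by
  simpa using congrArg (expand w hw) (mk_one_mul_one_sub_eq_one R)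

theorem mk_ncard_weighted_sum_mul_prod {ι : Type*} [Fintype ι] {w : ι → ℕ} (hw : ∀ i, w i ≠ 0) :
    (mk fun N => ({B : ι → ℕ | ∑ i, w i * B i = N}.ncard : R)) * ∏ i, (1 - X ^ w i) = 1 := by
  classical
  have hprod : (mk fun N => ({B : ι → ℕ | ∑ i, w i * B i = N}.ncard : R)) =
      ∏ i, expand (w i) (hw i) (mk 1) := by
    ext N
    rw [coeff_mk, coeff_prod]
    simp only [coeff_expand_mk_one, Finset.prod_ite_zero, Finset.prod_const_one]
    rw [Finset.sum_boole, ← Set.ncard_coe_finset]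
    congr 1
    refine Set.ncard_congr (fun B _ => Finsupp.equivFunOnFinite.symm fun i => w i * B i) ?_ ?_ ?_
    · intro B hB
      simpa using hB
    · intro B C _ _ h
      funext i
      simpa [hw i] using DFunLike.congr_fun h i
    · intro l hl
      simp only [Finset.coe_filter, Finset.mem_finsuppAntidiag, Set.mem_ofPred_eq] at hl
      have hdvd i : w i * (l i / w i) = l i := Nat.mul_div_cancel' (hl.2 i (Finset.mem_univ i))
      refine ⟨fun i => l i / w i, ?_, Finsupp.ext hdvd⟩
      simpa [hdvd] using hl.1.1
  rw [hprod, ← Finset.prod_mul_distrib]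
  exact Finset.prod_eq_one fun i _ => expand_mk_one_mul_one_sub_X_pow (hw i)

theorem mk_ncard_multisets_mul_prod_of_surjective {γ ι : Type*} [Fintype γ] [DecidableEq γ]
    [Fintype ι] [DecidableEq ι] {κ : γ → ι} (hκ : Function.Surjective κ) :
    (mk fun N => ({M : Multiset γ | M.card = N ∧
        ∀ x y, κ x = κ y → M.count x = M.count y}.ncard : R)) *
      ∏ i, (1 - X ^ (Finset.univ.filter (κ · = i)).card) = 1 := by
  have hfib i : (Finset.univ.filter (κ · = i)).card ≠ 0 := by
    obtain ⟨x, rfl⟩ := hκ i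
    exact Finset.card_ne_zero_of_mem (Finset.mem_filter.2 ⟨Finset.mem_univ x, rfl⟩)
  have hcard (B : ι → ℕ) : ∑ x, B (κ x) = ∑ i, (Finset.univ.filter (κ · = i)).card * B i := by
    rw [← Finset.sum_fiberwise Finset.univ κ]
    exact Finset.sum_congr rfl fun i _ => Finset.sum_const_nat fun x hx =>
      congrArg B (Finset.mem_filter.1 hx).2
  refine Eq.trans ?_ (mk_ncard_weighted_sum_mul_prod (R := R) hfib)
  congr
  funext N
  congr 1
  symm
  refine Set.ncard_congr
    (fun B _ => Finsupp.toMultiset (Finsupp.equivFunOnFinite.symm (B ∘ κ))) ?_ ?_ ?_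
  · intro B hB
    refine ⟨?_, fun x y hxy => by simp [hxy]⟩
    simpa [Finsupp.card_toMultiset, Finsupp.sum_fintype, hcard] using hB
  · intro B C _ _ h
    exact hκ.injective_comp_right <|
      Finsupp.equivFunOnFinite.symm.injective (Finsupp.orderIsoMultiset.injective h)
  · rintro M ⟨rfl, hM⟩
    have hcount x : M.count (Function.surjInv hκ (κ x)) = M.count x :=
      hM _ _ (Function.surjInv_eq hκ _)
    refine ⟨fun i => M.count (Function.surjInv hκ i), ?_, ?_⟩
    · rw [Set.mem_ofPred_eq, ← hcard]
      simp [hcount]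
    · ext x
      simp [hcount]

theorem mk_ncard_multisets_mul_prod {γ δ : Type*} [Fintype γ] [DecidableEq γ] [DecidableEq δ]
    (κ : γ → δ) :
    (mk fun N => ({M : Multiset γ | M.card = N ∧
        ∀ x y, κ x = κ y → M.count x = M.count y}.ncard : R)) *
      ∏ d ∈ Finset.univ.image κ, (1 - X ^ (Finset.univ.filter (κ · = d)).card) = 1 := by
  let κ' (x : γ) : Finset.univ.image κ := ⟨κ x, Finset.mem_image_of_mem κ (Finset.mem_univ x)⟩
  have hκ' : Function.Surjective κ' := fun ⟨d, hd⟩ => by simpa [κ'] using hd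
  rw [← Finset.prod_coe_sort]
  simpa [κ', Subtype.ext_iff] using mk_ncard_multisets_mul_prod_of_surjective (R := R) hκ'

theorem map_eq_self_iff_count {γ : Type*} [DecidableEq γ] {φ : γ → γ} (hφ : Function.Involutive φ)
    {M : Multiset γ} : M.map φ = M ↔ ∀ x, M.count (φ x) = M.count x := by
  refine ⟨fun h x => ?_, fun h => Multiset.ext.2 fun x => ?_⟩
  · conv_lhs => rw [← h, Multiset.count_map_eq_count' _ _ hφ.injective]
  · conv_lhs => rw [← hφ x, Multiset.count_map_eq_count' _ _ hφ.injective, h]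

variable {r : ℕ}

/-- A complete invariant of the orbits of pairs of labels under exchanging the components and under
negation. -/
def orbitKey (p : Omega r × Omega r) : ℕ × ℕ :=
  (max (p.1 : ℤ).natAbs (p.2 : ℤ).natAbs, ((p.1 : ℤ) + p.2).natAbs)

theorem orbitKey_eq_iff {p q : Omega r × Omega r} :
    orbitKey p = orbitKey q ↔ p = q ∨ p = q.swap ∨ p = Prod.map Omega.neg Omega.neg q ∨
      p = Prod.map Omega.neg Omega.neg q.swap := by
  simp only [orbitKey, Prod.ext_iff, Subtype.ext_iff, Prod.map_fst, Prod.map_snd, Prod.fst_swap,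
    Prod.snd_swap, Omega.coe_neg]
  omega

theorem mem_symmMultisets_iff {M : Multiset (Omega r × Omega r)} {N : ℕ} :
    M ∈ symmMultisets Omega.neg N ↔
      M.card = N ∧ ∀ p q, orbitKey p = orbitKey q → M.count p = M.count q := by
  have hneg : Function.Involutive (Prod.map (Omega.neg (n := r)) (Omega.neg (n := r))) :=
    Omega.neg_involutive.prodMap Omega.neg_involutive
  simp only [symmMultisets, Set.mem_ofPred_eq, map_eq_self_iff_count Prod.swap_swap,
    map_eq_self_iff_count hneg, orbitKey_eq_iff]
  refine and_congr_right fun _ => ⟨?_, fun h => ⟨fun p => h _ _ ?_, fun p => h _ _ ?_⟩⟩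
  · rintro ⟨hs, hn⟩ p q (rfl | rfl | rfl | rfl)
    exacts [rfl, hs q, hn q, (hn _).trans (hs q)]
  · simp
  · simp

theorem image_orbitKey : (Finset.univ : Finset (Omega r × Omega r)).image orbitKey =
    (Finset.range (r + 1)).biUnion fun m => (Finset.range (2 * m + 1)).image (Prod.mk m) := by
  ext ⟨m, s⟩
  simp only [Finset.mem_image, Finset.mem_univ, true_and, Finset.mem_biUnion, Finset.mem_range,
    orbitKey, Prod.mk.injEq, existsAndEq, and_true]
  refine ⟨?_, fun h => ?_⟩
  · rintro ⟨⟨⟨a, ha⟩, ⟨b, hb⟩⟩, rfl, rfl⟩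
    rw [Finset.mem_Icc] at ha hb
    simp only
    omega
  · have hmem : (m : ℤ) ∈ Finset.Icc (-r : ℤ) r := Finset.mem_Icc.2 (by omega)
    have hmem' : (s - m : ℤ) ∈ Finset.Icc (-r : ℤ) r := Finset.mem_Icc.2 (by omega)
    refine ⟨(⟨m, hmem⟩, ⟨s - m, hmem'⟩), ?_⟩
    simp only
    omega

theorem card_filter_orbitKey {m s : ℕ} (hm : m ≤ r) (hs : s ≤ 2 * m) :
    (Finset.univ.filter fun p : Omega r × Omega r => orbitKey p = (m, s)).card =
      if m = 0 then 1 else if s = 0 ∨ s = 2 * m then 2 else 4 := by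
  have hfib : (Finset.univ.filter fun p : Omega r × Omega r => orbitKey p = (m, s)).image
      (Prod.map Subtype.val Subtype.val) =
        {((m : ℤ), (s : ℤ) - m), ((s : ℤ) - m, (m : ℤ)),
          (-(m : ℤ), (m : ℤ) - s), ((m : ℤ) - s, -(m : ℤ))} := by
    ext ⟨a, b⟩
    simp only [Finset.mem_image, Finset.mem_filter, Finset.mem_univ, true_and, orbitKey,
      Prod.exists, Prod.mk.injEq, Prod.map_apply, Subtype.exists, Finset.mem_insert,
      Finset.mem_singleton, exists_and_right, Finset.mem_Icc, exists_prop, and_assoc]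
    constructor
    · rintro ⟨c, -, -, d, -, -, h1, h2, rfl, rfl⟩
      omega
    · intro h
      refine ⟨a, ?_, ?_, b, ?_, ?_, ?_, ?_, rfl, rfl⟩ <;> omega
  rw [← Finset.card_image_of_injective _ (Subtype.val_injective.prodMap Subtype.val_injective),
    hfib]
  split_ifs with h0 hs'
  · subst h0
    obtain rfl : s = 0 := by omega
    simp
  · refine Finset.card_eq_two.2 ⟨((m : ℤ), (s : ℤ) - m), (-(m : ℤ), (m : ℤ) - s), ?_, ?_⟩
    · simp only [ne_eq, Prod.mk.injEq]
      omega
    · ext ⟨a, b⟩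
      simp only [Finset.mem_insert, Finset.mem_singleton, Prod.mk.injEq]
      omega
  · repeat rw [Finset.card_insert_of_notMem]
    · simp
    all_goals
      simp only [Finset.mem_insert, Finset.mem_singleton, Prod.mk.injEq]
      omega

theorem prod_image_orbitKey {A : Type*} [CommMonoid A] (g : ℕ → A) (r : ℕ) :
    ∏ d ∈ (Finset.univ : Finset (Omega r × Omega r)).image orbitKey,
        g (Finset.univ.filter (orbitKey (r := r) · = d)).card =
      ∏ m ∈ Finset.range (r + 1), ∏ s ∈ Finset.range (2 * m + 1),
        g (if m = 0 then 1 else if s = 0 ∨ s = 2 * m then 2 else 4) := by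
  rw [image_orbitKey, Finset.prod_biUnion]
  · refine Finset.prod_congr rfl fun m hm => ?_
    rw [Finset.prod_image (Prod.mk_right_injective m).injOn]
    refine Finset.prod_congr rfl fun s hs => ?_
    rw [card_filter_orbitKey (Finset.mem_range_succ_iff.1 hm) (Finset.mem_range_succ_iff.1 hs)]
  · intro m _ m' _ hne
    simp only [Function.onFun, Finset.disjoint_left, Finset.mem_image, not_exists, not_and]
    rintro _ ⟨s, _, rfl⟩ s' _ h
    exact hne (congrArg Prod.fst h).symm

theorem prod_range_ite_eq_zero_or_eq_last {A : Type*} [CommMonoid A] (x y : A) (m : ℕ) :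
    ∏ s ∈ Finset.range (m + 2), (if s = 0 ∨ s = m + 1 then x else y) = x ^ 2 * y ^ m := by
  have hmid (s) (hs : s ∈ Finset.range m) :
      (if s + 1 = 0 ∨ s + 1 = m + 1 then x else y) = y :=
    if_neg (by have := Finset.mem_range.1 hs; omega)
  rw [Finset.prod_range_succ, Finset.prod_range_succ', Finset.prod_congr rfl hmid,
    Finset.prod_const, Finset.card_range, if_pos (.inl rfl), if_pos (.inr rfl), sq, mul_assoc,
    mul_comm]

theorem prod_card_filter_orbitKey {A : Type*} [CommMonoid A] (g : ℕ → A) (r : ℕ) :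
    ∏ d ∈ (Finset.univ : Finset (Omega r × Omega r)).image orbitKey,
        g (Finset.univ.filter (orbitKey (r := r) · = d)).card =
      g 1 * (g 2 ^ (2 * r) * g 4 ^ r ^ 2) := by
  rw [prod_image_orbitKey]
  induction r with
  | zero => simp
  | succ r ih =>
    rw [Finset.prod_range_succ, ih]
    simp only [Nat.add_one_ne_zero, if_false, apply_ite g]
    rw [show 2 * (r + 1) = 2 * r + 1 + 1 by ring, prod_range_ite_eq_zero_or_eq_last,
      show (r + 1) ^ 2 = r ^ 2 + (2 * r + 1) by ring, show 2 * r + 1 + 1 = 2 * r + 2 from rfl,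
      pow_add (g 2), pow_add (g 4) (r ^ 2), mul_assoc (g 1), mul_mul_mul_comm]

theorem mk_ncard_symmMultisets_mul (r : ℕ) :
    (mk fun N => ((symmMultisets (Omega.neg (n := r)) N).ncard : R)) *
      ((1 - X) * ((1 - X ^ 2) ^ (2 * r) * (1 - X ^ 4) ^ r ^ 2)) = 1 := by
  have h := mk_ncard_multisets_mul_prod (R := R) (orbitKey (r := r))
  rw [prod_card_filter_orbitKey fun w => (1 - X ^ w : R⟦X⟧)] at h
  simpa only [← mem_symmMultisets_iff, Set.ofPred_mem_eq, pow_one] using h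

theorem coeff_two_mul_expand_add (E O : R⟦X⟧) (n : ℕ) :
    coeff (2 * n) (expand 2 two_ne_zero E + X * expand 2 two_ne_zero O) = coeff n E := by
  rw [map_add, coeff_expand_mul, add_eq_left]
  cases n with
  | zero => simp
  | succ n => rw [Nat.mul_succ, coeff_succ_X_mul, coeff_expand_of_not_dvd _ _ _ (by omega)]

theorem coeff_two_mul_add_one_expand_add (E O : R⟦X⟧) (n : ℕ) :
    coeff (2 * n + 1) (expand 2 two_ne_zero E + X * expand 2 two_ne_zero O) = coeff n O := by
  rw [map_add, coeff_succ_X_mul, coeff_expand_mul, coeff_expand_of_not_dvd _ _ _ (by omega),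
    zero_add]

theorem mk_eq_expand_two_add (a : ℕ → R) :
    mk a = expand 2 two_ne_zero (mk fun n => a (2 * n)) +
      X * expand 2 two_ne_zero (mk fun n => a (2 * n + 1)) := by
  ext N
  obtain ⟨n, rfl | rfl⟩ := N.even_or_odd'
  · rw [coeff_two_mul_expand_add, coeff_mk, coeff_mk]
  · rw [coeff_two_mul_add_one_expand_add, coeff_mk, coeff_mk]

theorem mk_odd_mul_eq_one {a : ℕ → R} {H : R⟦X⟧}
    (h : mk a * ((1 - X) * expand 2 two_ne_zero H) = 1) :
    (mk fun n => a (2 * n + 1)) * ((1 - X) * H) = 1 := by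
  have hsplit : expand 2 two_ne_zero ((mk fun n => a (2 * n)) * ((1 - X) * H)) +
      X * expand 2 two_ne_zero ((mk fun n => a (2 * n + 1)) * ((1 - X) * H)) =
        expand 2 two_ne_zero 1 + X * expand 2 two_ne_zero 1 := by
    rw [mk_eq_expand_two_add a] at h
    simp only [map_mul, map_sub, map_one, expand_X]
    linear_combination (1 + X) * h
  ext n
  simpa only [coeff_two_mul_add_one_expand_add] using congrArg (coeff (2 * n + 1)) hsplit

theorem mk_ncard_symmMultisets_odd_mul (r : ℕ) :
    (mk fun n => ((symmMultisets (Omega.neg (n := r)) (2 * n + 1)).ncard : R)) *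
      ((1 - X) ^ (2 * r + 1) * (1 - X ^ 2) ^ r ^ 2) = 1 := by
  have h := mk_odd_mul_eq_one (R := R) (H := (1 - X) ^ (2 * r) * (1 - X ^ 2) ^ r ^ 2) <| by
    simpa [← pow_mul] using mk_ncard_symmMultisets_mul r
  rwa [pow_succ', mul_assoc]

end InvariantMultisets

section LogarithmicDerivative

open PowerSeries

variable {R : Type*} [CommRing R]

/-- The derivation `X d/dX`, which multiplies the coefficient of `X ^ n` by `n`. -/
noncomputable def euler : Derivation R R⟦X⟧ R⟦X⟧ := (X : R⟦X⟧) • d⁄dX R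

theorem euler_apply (f : R⟦X⟧) : euler f = X * d⁄dX R f := rfl

theorem coeff_euler (f : R⟦X⟧) (n : ℕ) : coeff n (euler f) = n * coeff n f := by
  cases n with
  | zero => simp [euler_apply]
  | succ n =>
    rw [euler_apply, coeff_succ_X_mul, coeff_derivative]
    push_cast
    ring

theorem mul_derivative_pow (u : R⟦X⟧) (k : ℕ) :
    u * d⁄dX R (u ^ k) = k * u ^ k * d⁄dX R u := by
  cases k with
  | zero => simp
  | succ k =>
    simp only [Derivation.leibniz_pow, smul_eq_mul, nsmul_eq_mul, Nat.add_sub_cancel]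
    ring

theorem one_sub_X_sq_mul_derivative {F : R⟦X⟧} {p q : ℕ}
    (h : F * ((1 - X) ^ p * (1 - X ^ 2) ^ q) = 1) :
    (1 - X ^ 2) * d⁄dX R F = ((p : R⟦X⟧) * (1 + X) + 2 * (q : R⟦X⟧) * X) * F := by
  set S : R⟦X⟧ := (1 - X) ^ p
  set T : R⟦X⟧ := (1 - X ^ 2) ^ q
  have hS : (1 - X) * d⁄dX R S = -((p : R⟦X⟧) * S) := by
    rw [mul_derivative_pow]
    simp [S]
  have hT : (1 - X ^ 2) * d⁄dX R T = -(2 * (q : R⟦X⟧) * X * T) := by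
    rw [mul_derivative_pow]
    simp only [map_sub, Derivation.map_one_eq_zero, Derivation.leibniz_pow, derivative_X,
      smul_eq_mul, nsmul_eq_mul, Nat.add_one_sub_one]
    push_cast
    ring
  have hF : S * T * d⁄dX R F + F * (S * d⁄dX R T + T * d⁄dX R S) = 0 := by
    have hderiv := congrArg (d⁄dX R) h
    simp only [Derivation.leibniz, Derivation.map_one_eq_zero, smul_eq_mul] at hderiv
    linear_combination hderiv
  linear_combination
    (((p : R⟦X⟧) * (1 + X) + 2 * (q : R⟦X⟧) * X) * F - (1 - X ^ 2) * d⁄dX R F) * h +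
      F * ((1 - X ^ 2) * hF - F * T * (1 + X) * hS - F * S * hT)

theorem derivative_sub_X_mul_euler {F : R⟦X⟧} {p q : ℕ}
    (h : F * ((1 - X) ^ p * (1 - X ^ 2) ^ q) = 1) :
    d⁄dX R F - X * euler F = p • F + (p + 2 * q) • (X * F) := by
  simp only [euler_apply, nsmul_eq_mul]
  push_cast
  linear_combination one_sub_X_sq_mul_derivative h

theorem coeff_zero_of_mul_eq_one {F : R⟦X⟧} {p q : ℕ}
    (h : F * ((1 - X) ^ p * (1 - X ^ 2) ^ q) = 1) : coeff 0 F = 1 := by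
  simpa using congrArg (coeff 0) h

theorem coeff_one_of_mul_eq_one {F : R⟦X⟧} {p q : ℕ}
    (h : F * ((1 - X) ^ p * (1 - X ^ 2) ^ q) = 1) : coeff 1 F = p := by
  have hcoeff := congrArg (coeff 0) (derivative_sub_X_mul_euler h)
  simp only [map_sub, map_add, map_nsmul, coeff_derivative, coeff_zero_X_mul,
    coeff_zero_of_mul_eq_one h] at hcoeff
  simpa using hcoeff

theorem coeff_add_two_of_mul_eq_one {F : R⟦X⟧} {p q : ℕ}
    (h : F * ((1 - X) ^ p * (1 - X ^ 2) ^ q) = 1) (n : ℕ) :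
    (n + 2) * coeff (n + 2) F = p * coeff (n + 1) F + (p + 2 * q + n) * coeff n F := by
  have hcoeff := congrArg (coeff (n + 1)) (derivative_sub_X_mul_euler h)
  simp only [map_sub, map_add, map_nsmul, coeff_derivative, coeff_succ_X_mul,
    coeff_euler] at hcoeff
  simp only [nsmul_eq_mul] at hcoeff
  push_cast at hcoeff
  linear_combination hcoeff

end LogarithmicDerivative

section EulerianOperator

open PowerSeries

variable {R : Type*} [CommRing R]

/-- The Eulerian operator: it describes the effect of `X d/dX` on the numerator of a fraction with
denominator `(1 - X) ^ m`. -/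
noncomputable def eulerianOp (m : ℕ) (P : R⟦X⟧) : R⟦X⟧ := (1 - X) * euler P + m • (X * P)

theorem eulerianOp_one_sub_X_pow_mul (m : ℕ) (G : R⟦X⟧) :
    eulerianOp m ((1 - X) ^ m * G) = (1 - X) ^ (m + 1) * euler G := by
  have h := mul_derivative_pow (1 - X : R⟦X⟧) m
  simp only [map_sub, derivative_X, Derivation.map_one_eq_zero] at h
  simp only [eulerianOp, euler_apply, Derivation.leibniz, smul_eq_mul, nsmul_eq_mul]
  linear_combination X * G * h

/-- The coefficient of a power series at an integer, which is `0` at negative integers. -/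
noncomputable def coeffInt (k : ℤ) : R⟦X⟧ →ₗ[R] R := if 0 ≤ k then coeff k.toNat else 0

theorem coeffInt_natCast (k : ℕ) (f : R⟦X⟧) : coeffInt (k : ℤ) f = coeff k f := by
  simp [coeffInt]

theorem coeffInt_of_neg {k : ℤ} (hk : k < 0) (f : R⟦X⟧) : coeffInt k f = 0 := by
  simp [coeffInt, hk.not_ge]

theorem coeffInt_one (k : ℤ) : coeffInt k (1 : R⟦X⟧) = if k = 0 then 1 else 0 := by
  rcases lt_or_ge k 0 with hk | hk
  · rw [coeffInt_of_neg hk, if_neg hk.ne]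
  · lift k to ℕ using hk
    rw [coeffInt_natCast, coeff_one]
    norm_cast

theorem coeffInt_X_mul (k : ℤ) (f : R⟦X⟧) : coeffInt k (X * f) = coeffInt (k - 1) f := by
  rcases lt_trichotomy k 0 with hk | rfl | hk
  · rw [coeffInt_of_neg hk, coeffInt_of_neg (by omega)]
  · simp [coeffInt]
  · lift k - 1 to ℕ using by omega with m hm
    rw [show k = ((m + 1 : ℕ) : ℤ) by push_cast; omega, coeffInt_natCast, coeffInt_natCast,
      coeff_succ_X_mul]

theorem coeffInt_euler (k : ℤ) (f : R⟦X⟧) : coeffInt k (euler f) = k * coeffInt k f := by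
  rcases lt_or_ge k 0 with hk | hk
  · simp [coeffInt_of_neg hk]
  · lift k to ℕ using hk
    simp [coeffInt_natCast, coeff_euler]

theorem coeffInt_one_sub_X_mul (k : ℤ) (f : R⟦X⟧) :
    coeffInt k ((1 - X) * f) = coeffInt k f - coeffInt (k - 1) f := by
  rw [sub_mul, one_mul, map_sub, coeffInt_X_mul]

theorem coeffInt_eulerianOp (k : ℤ) (m : ℕ) (P : R⟦X⟧) :
    coeffInt k (eulerianOp m P) = k * coeffInt k P + (m - k + 1) * coeffInt (k - 1) P := by
  rw [eulerianOp, map_add, map_nsmul, coeffInt_one_sub_X_mul, coeffInt_euler, coeffInt_euler,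
    coeffInt_X_mul, nsmul_eq_mul]
  push_cast
  ring

end EulerianOperator

section DescentPolynomials

open PowerSeries

/-- The descent polynomial of the signed involutions of length `n`, as a power series. -/
noncomputable def descentSeries (n : ℕ) : ℤ⟦X⟧ := mk fun k => (numInvolutions n k : ℤ)

theorem numInvolutions_of_neg (n : ℕ) {k : ℤ} (hk : k < 0) : numInvolutions n k = 0 := by
  rw [numInvolutions, Finset.card_eq_zero, Finset.filter_eq_empty_iff]
  intros
  omega

theorem coeffInt_descentSeries (n : ℕ) (k : ℤ) :
    coeffInt k (descentSeries n) = numInvolutions n k := by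
  rcases lt_or_ge k 0 with hk | hk
  · rw [coeffInt_of_neg hk, numInvolutions_of_neg n hk, Nat.cast_zero]
  · lift k to ℕ using hk
    rw [coeffInt_natCast, descentSeries, coeff_mk]

theorem descentSeries_eq_sum (n : ℕ) :
    descentSeries n = ∑ π ∈ signedInvolutions n, (X : ℤ⟦X⟧) ^ des π := by
  ext k
  simp only [descentSeries, coeff_mk, map_sum, coeff_X_pow, numInvolutions, Finset.sum_boole,
    Nat.cast_inj, eq_comm]

/-- The generating function in `r` of the numbers of symmetric multisets of `2 * n + 1` pairs of
labels in `Omega r`. -/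
noncomputable def multisetSeries (n : ℕ) : ℤ⟦X⟧ :=
  mk fun r => ((symmMultisets (Omega.neg (n := r)) (2 * n + 1)).ncard : ℤ)

theorem multisetSeries_zero : multisetSeries 0 = mk 1 := by
  ext r
  simpa [multisetSeries] using coeff_zero_of_mul_eq_one (mk_ncard_symmMultisets_odd_mul (R := ℤ) r)

theorem multisetSeries_one :
    multisetSeries 1 = 2 • euler (multisetSeries 0) + multisetSeries 0 := by
  ext r
  have h := coeff_one_of_mul_eq_one (mk_ncard_symmMultisets_odd_mul (R := ℤ) r)
  rw [multisetSeries_zero, map_add, map_nsmul, coeff_euler]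
  simpa [multisetSeries] using h

theorem multisetSeries_add_two (n : ℕ) :
    (n + 2) • multisetSeries (n + 2) =
      2 • euler (multisetSeries (n + 1)) + multisetSeries (n + 1) +
        2 • euler (euler (multisetSeries n)) + 2 • euler (multisetSeries n) +
        (n + 1) • multisetSeries n := by
  ext r
  have h := coeff_add_two_of_mul_eq_one (mk_ncard_symmMultisets_odd_mul (R := ℤ) r) n
  simp only [map_add, map_nsmul, coeff_euler, multisetSeries, coeff_mk] at h ⊢
  simp only [nsmul_eq_mul]
  push_cast at h ⊢
  linear_combination h

theorem one_sub_X_pow_mul_mk_multichoose {R : Type*} [CommRing R] {d n : ℕ} (h : d ≤ n) :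
    (1 - X : R⟦X⟧) ^ (n + 1) * (mk fun r => ((r + 1 - d).multichoose n : R)) = X ^ d := by
  have hmk : (mk fun r => ((r + 1 - d).multichoose n : R)) = X ^ d * (mk 1 : R⟦X⟧) ^ (n + 1) := by
    rw [mk_one_pow_eq_mk_choose_add]
    ext r
    rw [coeff_X_pow_mul', coeff_mk]
    split_ifs with hr
    · rw [coeff_mk, Nat.multichoose_eq]
      congr 2
      omega
    · rw [show r + 1 - d = 0 by omega]
      obtain ⟨m, rfl⟩ : ∃ m, n = m + 1 := ⟨n - 1, by omega⟩
      simp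
  rw [hmk, mul_left_comm, ← mul_pow, mul_comm (1 - X), mk_one_mul_one_sub_eq_one, one_pow, mul_one]

theorem des_le {n : ℕ} (π : Perm (Omega n)) : des π ≤ n :=
  (Finset.card_le_univ _).trans_eq (Fintype.card_fin n)

theorem descentSeries_eq (n : ℕ) :
    descentSeries n = (1 - X) ^ (n + 1) * multisetSeries n := by
  have h : multisetSeries n =
      ∑ π ∈ signedInvolutions n, mk fun r => ((r + 1 - des π).multichoose n : ℤ) := by
    ext r
    rw [multisetSeries, coeff_mk, map_sum, ncard_symmMultisets_eq_sum, Nat.cast_sum]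
    simp only [coeff_mk]
  rw [h, Finset.mul_sum, descentSeries_eq_sum]
  exact Finset.sum_congr rfl fun π _ => (one_sub_X_pow_mul_mk_multichoose (des_le π)).symm

theorem eulerianOp_descentSeries (n : ℕ) :
    eulerianOp (n + 1) (descentSeries n) = (1 - X) ^ (n + 2) * euler (multisetSeries n) := by
  rw [descentSeries_eq, eulerianOp_one_sub_X_pow_mul]

theorem descentSeries_zero : descentSeries 0 = 1 := by
  rw [descentSeries_eq, multisetSeries_zero, pow_one, mul_comm, mk_one_mul_one_sub_eq_one]

theorem descentSeries_one : descentSeries 1 = 1 + X := by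
  have h : descentSeries 1 =
      2 • eulerianOp 1 (descentSeries 0) + (1 - X) * descentSeries 0 := by
    rw [eulerianOp_descentSeries, descentSeries_eq, descentSeries_eq, multisetSeries_one]
    simp only [nsmul_eq_mul]
    ring
  rw [h, descentSeries_zero]
  simp only [eulerianOp, Derivation.map_one_eq_zero, nsmul_eq_mul]
  push_cast
  ring

theorem descentSeries_add_two (n : ℕ) :
    (n + 2) • descentSeries (n + 2) =
      2 • eulerianOp (n + 2) (descentSeries (n + 1)) + (1 - X) * descentSeries (n + 1) +
        2 • eulerianOp (n + 2) (eulerianOp (n + 1) (descentSeries n)) +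
        2 • ((1 - X) * eulerianOp (n + 1) (descentSeries n)) +
        (n + 1) • ((1 - X) * ((1 - X) * descentSeries n)) := by
  have h := multisetSeries_add_two n
  rw [eulerianOp_descentSeries, eulerianOp_descentSeries, eulerianOp_one_sub_X_pow_mul]
  simp only [descentSeries_eq, nsmul_eq_mul] at h ⊢
  linear_combination (1 - X) ^ (n + 3) * h

theorem numInvolutions_zero (k : ℤ) : numInvolutions 0 k = if k = 0 then 1 else 0 := by
  rw [← @Nat.cast_inj ℤ, ← coeffInt_descentSeries, descentSeries_zero, coeffInt_one]
  push_cast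
  rfl

theorem numInvolutions_one (k : ℤ) : numInvolutions 1 k = if k = 0 ∨ k = 1 then 1 else 0 := by
  rw [← @Nat.cast_inj ℤ, ← coeffInt_descentSeries, descentSeries_one, map_add, ← mul_one X,
    coeffInt_X_mul, coeffInt_one, coeffInt_one]
  grind

theorem numInvolutions_add_two (n : ℕ) (k : ℤ) :
    ((n : ℤ) + 2) * numInvolutions (n + 2) k =
      (2 * k + 1) * numInvolutions (n + 1) k +
      (2 * n - 2 * k + 5) * numInvolutions (n + 1) (k - 1) +
      (n + 1 + 2 * k * (k + 1)) * numInvolutions n k +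
      (2 * (n + 1) + 4 * (n + 1 - k) * (k - 1)) * numInvolutions n (k - 1) +
      ((2 * n + 1) * (n + 1) + 2 * (k - 2) * (k - 2 * n - 3)) * numInvolutions n (k - 2) := by
  have h := congrArg (coeffInt k) (descentSeries_add_two n)
  simp only [map_add, map_nsmul, coeffInt_eulerianOp, coeffInt_one_sub_X_mul,
    coeffInt_descentSeries, sub_sub, one_add_one_eq_two] at h
  simp only [nsmul_eq_mul] at h
  push_cast at h
  linear_combination h

theorem numInvolutions_two :
    numInvolutions 2 0 = 1 ∧ numInvolutions 2 1 = 4 ∧ numInvolutions 2 2 = 1 := by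
  have h₀ := numInvolutions_add_two 0 0
  have h₁ := numInvolutions_add_two 0 1
  have h₂ := numInvolutions_add_two 0 2
  simp only [zero_add, numInvolutions_zero, numInvolutions_one] at h₀ h₁ h₂
  norm_num at h₀ h₁ h₂
  omega

end DescentPolynomials

end SignedPerm

theorem mainTheorem4 :
    (∀ (n : ℕ) (k : ℤ), 3 ≤ n → 0 ≤ k →
      (n : ℤ) * (SignedPerm.numInvolutions n k : ℤ) =
        (2 * k + 1) * (SignedPerm.numInvolutions (n - 1) k : ℤ)
        + (2 * (n : ℤ) - 2 * k + 1) * (SignedPerm.numInvolutions (n - 1) (k - 1) : ℤ)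
        + ((n : ℤ) - 1 + 2 * k * (k + 1)) * (SignedPerm.numInvolutions (n - 2) k : ℤ)
        + (2 * ((n : ℤ) - 1) + 4 * ((n : ℤ) - k - 1) * (k - 1))
          * (SignedPerm.numInvolutions (n - 2) (k - 1) : ℤ)
        + ((2 * (n : ℤ) - 3) * ((n : ℤ) - 1) + 2 * (k - 2) * (k - 2 * (n : ℤ) + 1))
          * (SignedPerm.numInvolutions (n - 2) (k - 2) : ℤ)) ∧
    SignedPerm.numInvolutions 1 0 = 1 ∧
    SignedPerm.numInvolutions 1 1 = 1 ∧
    SignedPerm.numInvolutions 2 0 = 1 ∧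
    SignedPerm.numInvolutions 2 1 = 4 ∧
    SignedPerm.numInvolutions 2 2 = 1 ∧
    (∀ (n : ℕ) (k : ℤ), 1 ≤ n → k < 0 → SignedPerm.numInvolutions n k = 0) := by
  refine ⟨fun n k hn _ => ?_, by simp [SignedPerm.numInvolutions_one],
    by simp [SignedPerm.numInvolutions_one], SignedPerm.numInvolutions_two.1,
    SignedPerm.numInvolutions_two.2.1, SignedPerm.numInvolutions_two.2.2,
    fun n k _ hk => SignedPerm.numInvolutions_of_neg n hk⟩
  obtain ⟨m, rfl⟩ : ∃ m, n = m + 2 := ⟨n - 2, by omega⟩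
  rw [show m + 2 - 1 = m + 1 by omega, show m + 2 - 2 = m by omega]
  push_cast
  linear_combination SignedPerm.numInvolutions_add_two m k
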